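/- Let $H$ be an infinite-dimensional separable complex Hilbert space and let $T$ be a bounded linear operator on $H$. Let $W_{\rm e}(T)$ denote the essential numerical range of $T$, i.e. the set of all $\lambda\in\mathbb C$ for which there is an orthonormal sequence $(x_k)_{k=1}^\infty$ in $H$ with $\lim_{k\to\infty}\langle Tx_k,x_k\rangle=\lambda$, and let $\mathcal D(T)$ denote the set of diagonals of $T$, i.e. the set of all sequences $(\langle Te_k,e_k\rangle)_{k=1}^\infty$, where $(e_k)_{k=1}^\infty$ runs through all orthonormal bases of $H$. Write $\mathbb D=\{z\in\mathbb C:|z|<1\}$. Suppose that $\|T\|\le 1$, that $W_{\rm e}(T)=\overline{\mathbb D}$, and that $T$ is not a Fredholm operator of index $0$. Let $(\lambda_k)_{k=1}^\infty\subset\mathbb D$. Then $$(\lambda_k)_{k=1}^\infty\in\mathcal D(T)\iff\sum_{k=1}^\infty(1-|\lambda_k|)=\infty.$$ -/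

import Mathlib

open Filter Topology

noncomputable section

namespace OperatorDiagonals

variable {H : Type*} [NormedAddCommGroup H] [InnerProductSpace ℂ H]

/-- The essential numerical range `W_e(T)`: all limits of `⟨T x_k, x_k⟩` along orthonormal
sequences `(x_k)`. Mathlib's inner product is linear in the second variable, so the
number `⟨T x, x⟩` (linear in the first variable) is `inner ℂ x (T x)`. -/
def essNumericalRange (T : H →L[ℂ] H) : Set ℂ :=
  {μ | ∃ x : ℕ → H, Orthonormal ℂ x ∧
    Tendsto (fun k => inner ℂ (x k) (T (x k))) atTop (𝓝 μ)}

/-- The set `𝒟(T)` of diagonals of `T`: all sequences `(⟨T e_k, e_k⟩)_k`, where `(e_k)` runs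
through the orthonormal bases of `H`. -/
def diagonals (T : H →L[ℂ] H) : Set (ℕ → ℂ) :=
  {d | ∃ e : HilbertBasis ℕ ℂ H, ∀ k, inner ℂ (e k) (T (e k)) = d k}

/-- The index `dim ker T - codim ran T`; meaningful when `T` is Fredholm, where both
dimensions are finite. -/
def fredholmIndex (T : H →L[ℂ] H) : ℤ :=
  (Module.finrank ℂ T.ker : ℤ) - (Module.finrank ℂ (H ⧸ T.range) : ℤ)

end OperatorDiagonals

end

/-!
If `e` is an orthonormal basis with `∑ (1 - |⟨T e_k, e_k⟩|) < ∞`, then `‖T‖ ≤ 1` gives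
`‖T e_k - u_k e_k‖² ≤ 2 (1 - |⟨T e_k, e_k⟩|)` for suitable phases `u_k`. So `T` differs from a
diagonal unitary by a Hilbert–Schmidt operator, hence from an invertible operator by one of
finite rank, and is Fredholm of index `0`.

Conversely, let the discs of centre `d_k` and radius `r_k` lie in `W_e(T)`, with `∑ r_k = ∞`. Since
numerical ranges are convex, interior points of `W_e(T)` are attained by unit vectors orthogonal to
any given finite-dimensional subspace. This leaves room to choose, inductively, `e_k` orthogonal to
its predecessors with `⟨T e_k, e_k⟩ = d_k` exactly and with a share of weight proportional to `r_k`
in a prescribed direction. Split the indices into infinitely many classes, each with divergent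
`∑ r_k`, and let the `i`-th class aim at the `i`-th vector of a dense sequence: by Bessel's
inequality that vector cannot keep a component orthogonal to all `e_k`, so `e` is a basis.
-/

namespace OperatorDiagonals

section FiniteRankPerturbation

variable {K V : Type*} [Field K] [AddCommGroup V] [Module K V]

theorem finrank_quotient_comap_subtype_of_sup_eq_top {R P : Submodule K V} (h : R ⊔ P = ⊤) :
    Module.finrank K (R ⧸ P.comap R.subtype) = Module.finrank K (V ⧸ P) := by
  have hker : LinearMap.ker (P.mkQ ∘ₗ R.subtype) = P.comap R.subtype := by
    rw [LinearMap.ker_comp, Submodule.ker_mkQ]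
  have hsurj : Function.Surjective (P.mkQ ∘ₗ R.subtype) := by
    rw [← LinearMap.range_eq_top, LinearMap.range_comp, Submodule.range_subtype,
      Submodule.map_mkQ_eq_top, sup_comm, h]
  rw [← hker]
  exact (LinearMap.quotKerEquivOfSurjective _ hsurj).finrank_eq

theorem finrank_ker_eq_finrank_quotient_range {f : V →ₗ[K] V}
    (hf : (f - LinearMap.id).HasFiniteRange) :
    Module.finrank K (LinearMap.ker f) = Module.finrank K (V ⧸ LinearMap.range f) := by
  set R := LinearMap.range (f - LinearMap.id)
  have : FiniteDimensional K R :=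
    (Submodule.fg_iff_finiteDimensional R).1 (LinearMap.hasFiniteRange_iff_range.1 hf)
  have hsub (x : V) : f x - x ∈ R := ⟨x, rfl⟩
  have hmem {x : V} : f x ∈ R ↔ x ∈ R :=
    ⟨fun h => by simpa using R.sub_mem h (hsub x), fun h => by simpa using R.add_mem (hsub x) h⟩
  let g : R →ₗ[K] R := f.restrict fun x hx => hmem.2 hx
  have hker : LinearMap.ker g = (LinearMap.ker f).comap R.subtype := by
    ext x
    simp [g, Subtype.ext_iff]
  have hker_le : LinearMap.ker f ≤ R := fun x hx => hmem.1 (by simp [LinearMap.mem_ker.1 hx])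
  have hrange : LinearMap.range g = (LinearMap.range f).comap R.subtype := by
    ext y
    exact ⟨fun ⟨x, hx⟩ => ⟨x, congrArg Subtype.val hx⟩,
      fun ⟨x, hx⟩ => ⟨⟨x, hmem.1 (hx ▸ y.2)⟩, Subtype.ext hx⟩⟩
  have hsup : R ⊔ LinearMap.range f = ⊤ := by
    refine eq_top_iff.2 fun x _ => ?_
    rw [← sub_sub_cancel (f x) x]
    exact sub_mem (Submodule.mem_sup_right ⟨x, rfl⟩) (Submodule.mem_sup_left (hsub x))
  have hrank := (LinearMap.finrank_range_add_finrank_ker g).trans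
    (Submodule.finrank_quotient_add_finrank (LinearMap.range g)).symm
  have hker_finrank := (Submodule.comapSubtypeEquivOfLe hker_le).finrank_eq
  rw [← hker] at hker_finrank
  rw [← finrank_quotient_comap_subtype_of_sup_eq_top hsup, ← hrange]
  lia

end FiniteRankPerturbation

section HilbertSchmidt

variable {ι 𝕜 E F : Type*} [RCLike 𝕜] [NormedAddCommGroup E] [InnerProductSpace 𝕜 E]
  [NormedAddCommGroup F] [NormedSpace 𝕜 F]

theorem norm_sum_inner_smul_sq_le {v : ι → E} (hv : Orthonormal 𝕜 v) (w : ι → F) (x : E)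
    (s : Finset ι) :
    ‖∑ i ∈ s, inner 𝕜 (v i) x • w i‖ ^ 2 ≤ ‖x‖ ^ 2 * ∑ i ∈ s, ‖w i‖ ^ 2 :=
  calc ‖∑ i ∈ s, inner 𝕜 (v i) x • w i‖ ^ 2
      ≤ (∑ i ∈ s, ‖inner 𝕜 (v i) x‖ * ‖w i‖) ^ 2 := by
        gcongr
        simpa only [norm_smul] using norm_sum_le s fun i => inner 𝕜 (v i) x • w i
    _ ≤ (∑ i ∈ s, ‖inner 𝕜 (v i) x‖ ^ 2) * ∑ i ∈ s, ‖w i‖ ^ 2 :=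
        Finset.sum_mul_sq_le_sq_mul_sq _ _ _
    _ ≤ ‖x‖ ^ 2 * ∑ i ∈ s, ‖w i‖ ^ 2 := by
        gcongr
        exact hv.sum_inner_products_le x

theorem exists_finset_forall_norm_apply_le (e : HilbertBasis ι 𝕜 E) {A : E →L[𝕜] F}
    (hA : Summable fun i => ‖A (e i)‖ ^ 2) {ε : ℝ} (hε : 0 < ε) :
    ∃ s : Finset ι, ∀ x ∈ (Submodule.span 𝕜 (e '' s))ᗮ, ‖A x‖ ≤ ε * ‖x‖ := by
  classical
  obtain ⟨s, hs⟩ := summable_iff_vanishing_norm.1 hA (ε ^ 2) (by positivity)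
  refine ⟨s, fun x hx => ?_⟩
  have hxs (i : ι) (hi : i ∈ s) : inner 𝕜 (e i) x = 0 :=
    Submodule.inner_right_of_mem_orthogonal
      (Submodule.subset_span (Set.mem_image_of_mem e (Finset.mem_coe.2 hi))) hx
  have hsum : HasSum (fun i => inner 𝕜 (e i) x • A (e i)) (A x) := by
    simpa [e.repr_apply_apply] using (e.hasSum_repr x).mapL A
  refine le_of_tendsto hsum.norm (Eventually.of_forall fun t => ?_)
  have htail : ∑ i ∈ t, inner 𝕜 (e i) x • A (e i) = ∑ i ∈ t \ s, inner 𝕜 (e i) x • A (e i) := by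
    refine (Finset.sum_subset Finset.sdiff_subset fun i hit his => ?_).symm
    rw [hxs i (by simp_all), zero_smul]
  rw [htail]
  refine le_of_sq_le_sq ?_ (by positivity)
  calc ‖∑ i ∈ t \ s, inner 𝕜 (e i) x • A (e i)‖ ^ 2
      ≤ ‖x‖ ^ 2 * ∑ i ∈ t \ s, ‖A (e i)‖ ^ 2 := norm_sum_inner_smul_sq_le e.orthonormal _ x _
    _ ≤ ‖x‖ ^ 2 * ε ^ 2 := by
        gcongr
        exact (Real.le_norm_self _).trans (hs _ Finset.sdiff_disjoint).le
    _ = (ε * ‖x‖) ^ 2 := by ring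

theorem exists_linearIsometryEquiv_apply_eq_smul [CompleteSpace E] (e : HilbertBasis ι 𝕜 E)
    {u : ι → 𝕜} (hu : ∀ i, ‖u i‖ = 1) : ∃ U : E ≃ₗᵢ[𝕜] E, ∀ i, U (e i) = u i • e i := by
  have hu_ne (i : ι) : u i ≠ 0 := norm_ne_zero_iff.1 (by simp [hu])
  have horth : Orthonormal 𝕜 fun i => u i • e i :=
    ⟨fun i => by simp [norm_smul, hu, e.orthonormal.1 i], fun i j hij => by
      simp [inner_smul_left, inner_smul_right, e.orthonormal.2 hij]⟩
  have hspan : ⊤ ≤ (Submodule.span 𝕜 (Set.range fun i => u i • e i)).topologicalClosure := by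
    rw [← e.dense_span]
    refine Submodule.topologicalClosure_mono (Submodule.span_le.2 ?_)
    rintro _ ⟨i, rfl⟩
    exact (Submodule.smul_mem_iff _ (hu_ne i)).1 (Submodule.subset_span ⟨i, rfl⟩)
  classical
  let f := HilbertBasis.mk horth hspan
  exact ⟨e.repr.trans f.repr.symm, fun i => by simp [f, e.repr_self]⟩

theorem norm_sub_smul_sq_le {x y : E} (hx : ‖x‖ = 1) (hy : ‖y‖ ≤ 1) {u : 𝕜} (hu : ‖u‖ = 1)
    (hxy : u * ‖inner 𝕜 x y‖ = inner 𝕜 x y) : ‖y - u • x‖ ^ 2 ≤ 2 * (1 - ‖inner 𝕜 x y‖) := by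
  have hre : RCLike.re (inner 𝕜 y (u • x)) = ‖inner 𝕜 x y‖ := by
    rw [inner_re_symm, inner_smul_left, ← hxy, ← mul_assoc, RCLike.conj_mul, hu]
    simp [hu]
  rw [@norm_sub_sq 𝕜, hre, norm_smul, hu, hx]
  nlinarith [norm_nonneg y]

end HilbertSchmidt

variable {H : Type*} [NormedAddCommGroup H] [InnerProductSpace ℂ H]

section Fredholm

open scoped LinearMap.FiniteRangeSetoid in
theorem isFredholm_and_fredholmIndex_eq_zero_of_hasFiniteRange {T : H →L[ℂ] H} {S : H ≃L[ℂ] H}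
    (h : (T - (S : H →L[ℂ] H)).toLinearMap.HasFiniteRange) :
    T.IsFredholm ∧ fredholmIndex T = 0 := by
  constructor
  · have hTS : T.toLinearMap ≈ S.toLinearEquiv.toLinearMap :=
      LinearMap.FiniteRangeSetoid.equiv_iff_hasFiniteRange.2 h
    exact ContinuousLinearMap.IsFredholm.of_isQuasiInverse (u := T) (v := (S.symm : H →L[ℂ] H))
      (S.toLinearEquiv.isQuasiInverse.congr (Setoid.refl _) hTS)
  · let f : H →ₗ[ℂ] H := T.toLinearMap ∘ₗ S.symm.toLinearEquiv.toLinearMap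
    have hf : (f - LinearMap.id).HasFiniteRange := by
      have : f - LinearMap.id = (T - (S : H →L[ℂ] H)).toLinearMap ∘ₗ
          S.symm.toLinearEquiv.toLinearMap := by
        ext x
        simp [f]
      rw [this]
      exact h.comp_right _
    have hker : LinearMap.ker f = T.ker.map S.toLinearEquiv.toLinearMap := by
      rw [LinearMap.ker_comp]
      exact (Submodule.map_equiv_eq_comap_symm S.toLinearEquiv T.ker).symm
    have hrange : LinearMap.range f = T.range := by simp [f, LinearMap.range_comp]
    rw [fredholmIndex, ← LinearEquiv.finrank_map_eq S.toLinearEquiv T.ker,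
      ← hrange, ← finrank_ker_eq_finrank_quotient_range hf, hker, sub_self]

variable [CompleteSpace H]

theorem isFredholm_and_fredholmIndex_eq_zero_of_summable_norm_sub_sq {ι : Type*}
    {T : H →L[ℂ] H} (S : H ≃L[ℂ] H) (e : HilbertBasis ι ℂ H)
    (h : Summable fun i => ‖T (e i) - S (e i)‖ ^ 2) : T.IsFredholm ∧ fredholmIndex T = 0 := by
  obtain ⟨ε, hε, hball⟩ := Metric.mem_nhds_iff.1 S.nhds
  set A : H →L[ℂ] H := T - S
  obtain ⟨s, hs⟩ := exists_finset_forall_norm_apply_le e (A := A) h (half_pos hε)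
  set F := Submodule.span ℂ (e '' s)
  have : FiniteDimensional ℂ F := .span_of_finite ℂ (s.finite_toSet.image e)
  have hnorm : ‖A ∘L Fᗮ.starProjection‖ ≤ ε / 2 :=
    ContinuousLinearMap.opNorm_le_bound _ (by positivity) fun x =>
      (hs _ (Fᗮ.starProjection_apply_mem x)).trans <| by
        gcongr
        exact Fᗮ.norm_starProjection_apply_le x
  obtain ⟨S', hS'⟩ : (S : H →L[ℂ] H) + A ∘L Fᗮ.starProjection ∈ Set.range ((↑) : (H ≃L[ℂ] H) → _) :=
    hball (by simpa using hnorm.trans_lt (half_lt_self hε))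
  refine isFredholm_and_fredholmIndex_eq_zero_of_hasFiniteRange (S := S') ?_
  have hdiff : T - (S' : H →L[ℂ] H) = A ∘L F.starProjection := by
    ext x
    simp only [hS', A, ContinuousLinearMap.sub_comp, sub_apply, add_apply,
      ContinuousLinearEquiv.coe_coe, ContinuousLinearMap.comp_apply,
      Submodule.starProjection_orthogonal_val, map_sub]
    abel
  rw [hdiff]
  have hF : F.starProjection.toLinearMap.HasFiniteRange := by
    rw [LinearMap.hasFiniteRange_iff_range, Submodule.range_starProjection]
    exact (Submodule.fg_iff_finiteDimensional F).2 this
  exact hF.comp_left _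

theorem isFredholm_and_fredholmIndex_eq_zero_of_summable {ι : Type*} {T : H →L[ℂ] H}
    (hT : ‖T‖ ≤ 1) (e : HilbertBasis ι ℂ H)
    (h : Summable fun i => 1 - ‖inner ℂ (e i) (T (e i))‖) :
    T.IsFredholm ∧ fredholmIndex T = 0 := by
  choose u hu hphase using fun i => Complex.exists_norm_mul_eq_self (inner ℂ (e i) (T (e i)))
  obtain ⟨U, hU⟩ := exists_linearIsometryEquiv_apply_eq_smul e hu
  refine isFredholm_and_fredholmIndex_eq_zero_of_summable_norm_sub_sq
    U.toContinuousLinearEquiv e (Summable.of_nonneg_of_le (fun _ => by positivity) (fun i => ?_)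
      (h.mul_left 2))
  have hTe : ‖T (e i)‖ ≤ 1 := by simpa [e.orthonormal.1 i] using T.le_of_opNorm_le hT (e i)
  simpa [hU] using norm_sub_smul_sq_le (e.orthonormal.1 i) hTe (hu i) (hphase i)

end Fredholm

section ConvexClosure

variable {E : Type*} [NormedAddCommGroup E] [NormedSpace ℝ E] [FiniteDimensional ℝ E]

theorem affineSpan_closure (s : Set E) : affineSpan ℝ (closure s) = affineSpan ℝ s :=
  le_antisymm
    (affineSpan_le.2 <|
      closure_minimal (subset_affineSpan ℝ s) (AffineSubspace.closed_of_finiteDimensional _))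
    (affineSpan_mono ℝ subset_closure)

theorem interior_closure_eq_interior_of_convex {s : Set E} (hs : Convex ℝ s) :
    interior (closure s) = interior s := by
  rcases (interior (closure s)).eq_empty_or_nonempty with hempty | hne
  · rw [hempty]
    exact (Set.subset_empty_iff.1 (hempty ▸ interior_mono subset_closure)).symm
  · rw [hs.closure.interior_nonempty_iff_affineSpan_eq_top, affineSpan_closure,
      ← hs.interior_nonempty_iff_affineSpan_eq_top] at hne
    exact hs.interior_closure_eq_interior_of_nonempty_interior hne

end ConvexClosure

section NumericalRange

theorem exists_norm_eq_one_conj_mul_add_mul_eq_ofReal (α β : ℂ) :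
    ∃ (u : ℂ) (κ : ℝ), ‖u‖ = 1 ∧ starRingEnd ℂ u * α + u * β = κ := by
  obtain ⟨u, hu, hphase⟩ := Complex.exists_norm_eq_mul_self (β - starRingEnd ℂ α)
  refine ⟨u, 2 * (starRingEnd ℂ u * α).re + ‖β - starRingEnd ℂ α‖, hu, ?_⟩
  have hre := Complex.add_conj (starRingEnd ℂ u * α)
  rw [map_mul, Complex.conj_conj] at hre
  rw [Complex.ofReal_add, hphase]
  linear_combination hre

/-- Multiplying `x` by a suitable phase makes the cross terms a real multiple of `w`; the equation
for the remaining real factor of `c` is then quadratic with nonnegative discriminant. -/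
theorem exists_smul_add_ne_zero_inner_map_eq_zero (A : H →ₗ[ℂ] H) {x y : H} (hy : y ≠ 0) {w : ℂ}
    {s t : ℝ} (hs : 0 ≤ s) (ht : 0 < t) (hAx : inner ℂ x (A x) = t * w)
    (hAy : inner ℂ y (A y) = -(s * w)) :
    ∃ c : ℂ, c • x + y ≠ 0 ∧ inner ℂ (c • x + y) (A (c • x + y)) = 0 := by
  rcases eq_or_ne w 0 with rfl | hw
  · exact ⟨0, by simpa using hy, by simpa using hAy⟩
  obtain ⟨u, κ, hu, hκ⟩ := exists_norm_eq_one_conj_mul_add_mul_eq_ofReal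
    (inner ℂ x (A y) / w) (inner ℂ y (A x) / w)
  obtain ⟨r, hr⟩ : ∃ r : ℝ, t * (r * r) + κ * r + -s = 0 := by
    have hdiscrim : 0 ≤ discrim t κ (-s) := by
      rw [discrim]
      nlinarith [mul_nonneg ht.le hs, sq_nonneg κ]
    exact exists_quadratic_eq_zero ht.ne' ⟨_, (Real.mul_self_sqrt hdiscrim).symm⟩
  have huu : starRingEnd ℂ u * u = 1 := by simp [Complex.conj_mul', hu]
  refine ⟨r * u, fun hzero => ?_, ?_⟩
  · have hyx : y = -((r * u) • x) := (neg_eq_of_add_eq_zero_right hzero).symm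
    have hsr : -s = r * r * t := by
      have : (-s : ℂ) * w = r * r * t * w := by
        rw [hyx] at hAy
        simp only [map_neg, map_smul, inner_neg_neg, inner_smul_left, inner_smul_right, hAx,
          map_mul, Complex.conj_ofReal] at hAy
        linear_combination -hAy + r * r * t * w * huu
      exact_mod_cast mul_right_cancel₀ hw this
    have hr0 : r = 0 := by
      have : r * r ≤ 0 := by nlinarith
      nlinarith [mul_self_nonneg r]
    exact hy (by simp [hyx, hr0])
  · have hrC : (t * (r * r) + κ * r + -s : ℂ) = 0 := by exact_mod_cast hr
    have hκw : starRingEnd ℂ u * inner ℂ x (A y) + u * inner ℂ y (A x) = κ * w := by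
      rw [← hκ]
      field_simp
    simp only [map_add, map_smul, inner_add_left, inner_add_right, inner_smul_left,
      inner_smul_right, hAx, hAy, map_mul, Complex.conj_ofReal]
    linear_combination w * hrC + r * hκw + r * r * t * w * huu

/-- The numerical range of the compression of `T` to `M`, described by the unit vectors of `M` so
that no projection onto `M` has to exist. -/
def compressionNumericalRange (T : H →L[ℂ] H) (M : Submodule ℂ H) : Set ℂ :=
  {z | ∃ v ∈ M, ‖v‖ = 1 ∧ inner ℂ v (T v) = z}

variable (T : H →L[ℂ] H)

theorem inner_div_norm_sq_mem_compressionNumericalRange {M : Submodule ℂ H} {v : H} (hv : v ∈ M)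
    (hv0 : v ≠ 0) : inner ℂ v (T v) / (‖v‖ : ℂ) ^ 2 ∈ compressionNumericalRange T M := by
  refine ⟨(‖v‖ : ℂ)⁻¹ • v, M.smul_mem _ hv, norm_smul_inv_norm hv0, ?_⟩
  rw [map_smul, inner_smul_left, inner_smul_right, map_inv₀, Complex.conj_ofReal]
  field_simp

/-- The Toeplitz–Hausdorff theorem. -/
theorem convex_compressionNumericalRange (M : Submodule ℂ H) :
    Convex ℝ (compressionNumericalRange T M) := by
  rintro _ ⟨x, hxM, hx, rfl⟩ _ ⟨y, hyM, hy, rfl⟩ a b ha hb hab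
  rcases hb.eq_or_lt with rfl | hb
  · obtain rfl : a = 1 := by linarith
    exact ⟨x, hxM, hx, by simp⟩
  set p := inner ℂ x (T x) with hp
  set q := inner ℂ y (T y) with hq
  have habC : (a + b : ℂ) = 1 := by exact_mod_cast hab
  let A : H →ₗ[ℂ] H := T.toLinearMap - (a • p + b • q) • LinearMap.id
  have hA (v : H) : inner ℂ v (A v) = inner ℂ v (T v) - (a * p + b * q) * (‖v‖ : ℂ) ^ 2 := by
    simp [A, inner_self_eq_norm_sq_to_K]
  obtain ⟨c, hne, hzero⟩ := exists_smul_add_ne_zero_inner_map_eq_zero A (w := p - q)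
    (x := x) (y := y) (by simp [← norm_ne_zero_iff, hy]) ha hb
    (by rw [hA, hx, ← hp]; push_cast; linear_combination -p * habC)
    (by rw [hA, hy, ← hq]; push_cast; linear_combination -q * habC)
  convert inner_div_norm_sq_mem_compressionNumericalRange T
    (M.add_mem (M.smul_mem c hxM) hyM) hne using 1
  rw [hA, sub_eq_zero] at hzero
  rw [hzero, mul_div_cancel_right₀ _ (by simpa using hne)]
  simp

end NumericalRange

section EssentialNumericalRange

theorem tendsto_starProjection_of_orthonormal {𝕜 E : Type*} [RCLike 𝕜] [NormedAddCommGroup E]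
    [InnerProductSpace 𝕜 E] (F : Submodule 𝕜 E) [FiniteDimensional 𝕜 F] {x : ℕ → E}
    (hx : Orthonormal 𝕜 x) : Tendsto (fun k => F.starProjection (x k)) atTop (𝓝 0) := by
  let b := stdOrthonormalBasis 𝕜 F
  have hweak (y : E) : Tendsto (fun k => inner 𝕜 y (x k)) atTop (𝓝 0) := by
    rw [tendsto_zero_iff_norm_tendsto_zero]
    simpa [Real.sqrt_sq, norm_inner_symm] using
      (hx.inner_products_summable y).tendsto_atTop_zero.sqrt
  have hsum (k : ℕ) : F.starProjection (x k) = ∑ i, inner 𝕜 (b i : E) (x k) • (b i : E) := by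
    rw [Submodule.starProjection_apply, b.orthogonalProjectionOnto_apply_eq_sum]
    simp
  simpa [hsum] using tendsto_finsetSum Finset.univ fun i _ =>
    (hweak (b i)).smul_const (b i : E)

variable (T : H →L[ℂ] H)

theorem norm_inner_map_sub_sub_inner_map_le (x p : H) :
    ‖inner ℂ (x - p) (T (x - p)) - inner ℂ x (T x)‖ ≤ ‖T‖ * (2 * ‖x‖ * ‖p‖ + ‖p‖ ^ 2) := by
  have hexpand : inner ℂ (x - p) (T (x - p)) - inner ℂ x (T x) =
      inner ℂ p (T p) - inner ℂ x (T p) - inner ℂ p (T x) := by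
    simp only [map_sub, inner_sub_left, inner_sub_right]
    ring
  have hbound (v w : H) : ‖inner ℂ v (T w)‖ ≤ ‖T‖ * (‖v‖ * ‖w‖) :=
    (norm_inner_le_norm v (T w)).trans <|
      (mul_le_mul_of_nonneg_left (T.le_opNorm w) (norm_nonneg v)).trans_eq (mul_left_comm _ _ _)
  rw [hexpand]
  linarith [norm_sub_le (inner ℂ p (T p) - inner ℂ x (T p)) (inner ℂ p (T x)),
    norm_sub_le (inner ℂ p (T p)) (inner ℂ x (T p)), hbound p p, hbound x p, hbound p x]

theorem essNumericalRange_subset_closure_compressionNumericalRange (F : Submodule ℂ H)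
    [FiniteDimensional ℂ F] :
    essNumericalRange T ⊆ closure (compressionNumericalRange T Fᗮ) := by
  rintro z ⟨x, hx, hlim⟩
  have hproj := tendsto_starProjection_of_orthonormal F hx
  let w (k : ℕ) : H := x k - F.starProjection (x k)
  have hnorm : Tendsto (fun k => ‖w k‖) atTop (𝓝 1) := by
    rw [tendsto_iff_dist_tendsto_zero]
    refine squeeze_zero (fun _ => dist_nonneg) (fun k => ?_) (by simpa using hproj.norm)
    simpa [w, hx.1 k, Real.dist_eq] using abs_norm_sub_norm_le (w k) (x k)
  have hinner : Tendsto (fun k => inner ℂ (w k) (T (w k))) atTop (𝓝 z) := by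
    have hbound : Tendsto
        (fun k => ‖T‖ * (2 * ‖x k‖ * ‖F.starProjection (x k)‖ + ‖F.starProjection (x k)‖ ^ 2))
        atTop (𝓝 0) := by
      simpa [hx.1] using ((hproj.norm.const_mul 2).add (hproj.norm.pow 2)).const_mul ‖T‖
    refine hlim.congr_dist (squeeze_zero (fun _ => dist_nonneg) (fun k => ?_) hbound)
    rw [dist_comm, dist_eq_norm]
    exact norm_inner_map_sub_sub_inner_map_le T _ _
  have hquot : Tendsto (fun k => inner ℂ (w k) (T (w k)) / (‖w k‖ : ℂ) ^ 2) atTop (𝓝 z) := by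
    simpa [Pi.div_def] using
      hinner.div (((Complex.continuous_ofReal.tendsto 1).comp hnorm).pow 2) (by simp)
  refine mem_closure_of_tendsto hquot ?_
  filter_upwards [hnorm.eventually_ne one_ne_zero] with k hk
  exact inner_div_norm_sq_mem_compressionNumericalRange T (by simp [w]) (norm_ne_zero_iff.1 hk)

theorem interior_essNumericalRange_subset_compressionNumericalRange (F : Submodule ℂ H)
    [FiniteDimensional ℂ F] :
    interior (essNumericalRange T) ⊆ compressionNumericalRange T Fᗮ :=
  calc interior (essNumericalRange T)
      ⊆ interior (closure (compressionNumericalRange T Fᗮ)) :=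
        interior_mono (essNumericalRange_subset_closure_compressionNumericalRange T F)
    _ = interior (compressionNumericalRange T Fᗮ) :=
        interior_closure_eq_interior_of_convex (convex_compressionNumericalRange T Fᗮ)
    _ ⊆ compressionNumericalRange T Fᗮ := interior_subset

theorem norm_inner_map_self_le {x : H} (hx : ‖x‖ = 1) : ‖inner ℂ x (T x)‖ ≤ ‖T‖ := by
  simpa [hx] using (norm_inner_le_norm x (T x)).trans
    (mul_le_mul_of_nonneg_left (T.le_opNorm x) (norm_nonneg x))

theorem essNumericalRange_subset_closedBall :
    essNumericalRange T ⊆ Metric.closedBall 0 ‖T‖ := by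
  rintro z ⟨x, hx, hlim⟩
  rw [mem_closedBall_zero_iff]
  exact le_of_tendsto hlim.norm (Eventually.of_forall fun k => norm_inner_map_self_le T (hx.1 k))

theorem le_norm_of_ball_subset_essNumericalRange {μ : ℂ} {r : ℝ} (hr : 0 ≤ r)
    (hμ : Metric.ball μ r ⊆ essNumericalRange T) : r ≤ ‖T‖ := by
  have hdiam := Metric.diam_mono (hμ.trans (essNumericalRange_subset_closedBall T))
    Metric.isBounded_closedBall
  rw [Metric.diam_ball_eq μ hr, Metric.diam_closedBall_eq 0 (norm_nonneg T)] at hdiam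
  linarith

end EssentialNumericalRange

section Sequences

theorem exists_strictMono_forall_one_le_sum_Ico {a : ℕ → ℝ}
    (ha : Tendsto (fun n => ∑ k ∈ Finset.range n, a k) atTop atTop) :
    ∃ N : ℕ → ℕ, StrictMono N ∧ ∀ j, 1 ≤ ∑ k ∈ Finset.Ico (N j) (N (j + 1)), a k := by
  have hstep (n : ℕ) : ∃ p, n < p ∧ 1 ≤ ∑ k ∈ Finset.Ico n p, a k := by
    obtain ⟨p, hnp, hp⟩ := ((eventually_gt_atTop n).and
      (ha.eventually_ge_atTop (∑ k ∈ Finset.range n, a k + 1))).exists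
    exact ⟨p, hnp, by rw [Finset.sum_Ico_eq_sub a hnp.le]; linarith⟩
  choose next hlt hsum using hstep
  have hsucc (j : ℕ) : next^[j + 1] 0 = next (next^[j] 0) := Function.iterate_succ_apply' ..
  refine ⟨fun j => next^[j] 0, strictMono_nat_of_lt_succ fun j => ?_, fun j => ?_⟩
  · simpa only [hsucc] using hlt (next^[j] 0)
  · simpa only [hsucc] using hsum (next^[j] 0)

theorem exists_forall_eq_of_mem_Ico {N : ℕ → ℕ} (hN : StrictMono N) :
    ∃ block : ℕ → ℕ, ∀ j, ∀ n ∈ Finset.Ico (N j) (N (j + 1)), block n = j := by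
  refine ⟨fun n => Nat.findGreatest (N · ≤ n) n, fun j n hn => ?_⟩
  obtain ⟨hjn, hnj⟩ := Finset.mem_Ico.1 hn
  refine Nat.findGreatest_eq_iff.2 ⟨(hN.le_apply).trans hjn, fun _ => hjn, fun i hi _ hin => ?_⟩
  exact absurd (hN.monotone hi) (by lia)

theorem exists_forall_not_summable_indicator_fiber {a : ℕ → ℝ} (ha₀ : 0 ≤ a)
    (ha : ¬ Summable a) : ∃ m : ℕ → ℕ, ∀ i, ¬ Summable ((m ⁻¹' {i}).indicator a) := by
  obtain ⟨N, hN, hsum⟩ := exists_strictMono_forall_one_le_sum_Ico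
    ((not_summable_iff_tendsto_nat_atTop_of_nonneg ha₀).1 ha)
  obtain ⟨block, hblock⟩ := exists_forall_eq_of_mem_Ico hN
  refine ⟨fun n => (Nat.unpair (block n)).1, fun i hsummable => ?_⟩
  obtain ⟨s, hs⟩ := summable_iff_vanishing_norm.1 hsummable 1 one_pos
  obtain ⟨K, hK⟩ := s.exists_nat_subset_range
  have hpair : K ≤ N (Nat.pair i K) := (Nat.right_le_pair i K).trans hN.le_apply
  have hlt := hs (Finset.Ico (N (Nat.pair i K)) (N (Nat.pair i K + 1))) <|
    Finset.disjoint_left.2 fun n hn hns => by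
      have := Finset.mem_range.1 (hK hns)
      have := (Finset.mem_Ico.1 hn).1
      lia
  rw [Finset.sum_congr rfl fun n hn => Set.indicator_of_mem (by simp [hblock _ n hn]) a] at hlt
  exact (hsum _).not_gt ((Real.le_norm_self _).trans_lt hlt)

theorem exists_seq_forall_rel_image_Iio {α : Type*} {R : ℕ → Set α → α → Prop}
    (h : ∀ n s, s.Finite → ∃ x, R n s x) : ∃ f : ℕ → α, ∀ n, R n (f '' Set.Iio n) (f n) := by
  have : Nonempty α := (h 0 ∅ Set.finite_empty).nonempty
  choose! next hnext using h
  let s (n : ℕ) : Set α := Nat.rec ∅ (fun n s => insert (next n s) s) n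
  have hs (n : ℕ) : s n = (fun k => next k (s k)) '' Set.Iio n := by
    induction n with
    | zero => simp [s]
    | succ n ih =>
      rw [← Order.succ_eq_add_one, Order.Iio_succ_eq_insert, Set.image_insert_eq, ← ih]
      rfl
  refine ⟨fun n => next n (s n), fun n => ?_⟩
  rw [← hs]
  exact hnext n _ (hs n ▸ (Set.finite_Iio n).image _)

end Sequences

section Completeness

variable {𝕜 E ι κ : Type*} [RCLike 𝕜] [NormedAddCommGroup E] [InnerProductSpace 𝕜 E]

theorem orthonormal_of_forall_mem_orthogonal_span_image_Iio {e : ℕ → E} (hnorm : ∀ n, ‖e n‖ = 1)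
    (horth : ∀ n, e n ∈ (Submodule.span 𝕜 (e '' Set.Iio n))ᗮ) : Orthonormal 𝕜 e := by
  have hlt {i j : ℕ} (hij : i < j) : inner 𝕜 (e i) (e j) = 0 :=
    Submodule.inner_right_of_mem_orthogonal
      (Submodule.subset_span (Set.mem_image_of_mem e hij)) (horth j)
  exact ⟨hnorm, fun i j hij => hij.lt_or_gt.elim hlt fun hji => inner_eq_zero_symm.1 (hlt hji)⟩

theorem norm_inner_le_norm_mul_norm_starProjection {K : Submodule 𝕜 E}
    [K.HasOrthogonalProjection] {w : E} (hw : w ∈ K) (y : E) :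
    ‖inner 𝕜 w y‖ ≤ ‖w‖ * ‖K.starProjection y‖ := by
  rw [← Submodule.starProjection_eq_self_iff.2 hw, K.inner_starProjection_left_eq_right,
    Submodule.starProjection_eq_self_iff.2 hw]
  exact norm_inner_le_norm _ _

/-- If `w` were orthogonal to `e` but not to `y i`, then Bessel's inequality for `y i` would make
`r` summable over the fiber of `m` above `i`. -/
theorem orthogonal_span_range_eq_bot_of_not_summable {e : ι → E} (he : Orthonormal 𝕜 e)
    {y : κ → E} (hy : DenseRange y) {m : ι → κ} {r : ι → ℝ} (hr : 0 ≤ r)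
    (hm : ∀ i, ¬ Summable ((m ⁻¹' {i}).indicator r))
    (h : ∀ w ∈ (Submodule.span 𝕜 (Set.range e))ᗮ, ∃ C, ∀ k,
      r k * ‖inner 𝕜 w (y (m k))‖ ^ 2 ≤ C * ‖inner 𝕜 (e k) (y (m k))‖ ^ 2) :
    (Submodule.span 𝕜 (Set.range e))ᗮ = ⊥ := by
  refine (Submodule.eq_bot_iff _).2 fun w hw => ?_
  obtain ⟨C, hC⟩ := h w hw
  have hwy (i : κ) : inner 𝕜 w (y i) = 0 := by
    by_contra hne
    have hpos : 0 < ‖inner 𝕜 w (y i)‖ ^ 2 := by positivity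
    have hbessel : Summable fun k => C * ‖inner 𝕜 (e k) (y i)‖ ^ 2 / ‖inner 𝕜 w (y i)‖ ^ 2 :=
      ((he.inner_products_summable (y i)).mul_left C).div_const _
    refine hm i (Summable.of_nonneg_of_le (Set.indicator_nonneg fun k _ => hr k) (fun k => ?_)
      (hbessel.indicator (m ⁻¹' {i})))
    refine Set.indicator_le_indicator' fun hk => ?_
    obtain rfl : m k = i := hk
    exact (le_div_iff₀ hpos).2 (hC k)
  have hzero : (fun x => inner 𝕜 w x) = fun _ => 0 :=
    hy.equalizer (by fun_prop) continuous_const (funext hwy)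
  exact inner_self_eq_zero.1 (congrFun hzero w)

end Completeness

section Construction

variable [CompleteSpace H] (T : H →L[ℂ] H) (M : Submodule ℂ H) [FiniteDimensional ℂ M]

theorem exists_decoupled_inner_map_eq_of_mem_interior {ν : ℂ}
    (hν : ν ∈ interior (essNumericalRange T)) (b : H) :
    ∃ v ∈ Mᗮ, ‖v‖ = 1 ∧ inner ℂ v (T v) = ν ∧
      inner ℂ b v = 0 ∧ inner ℂ b (T v) = 0 ∧ inner ℂ v (T b) = 0 := by
  let B : Set H := {b, T b, ContinuousLinearMap.adjoint T b}
  have : FiniteDimensional ℂ (Submodule.span ℂ B) := .span_of_finite ℂ (by simp [B])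
  obtain ⟨v, hv, hnorm, hinner⟩ :=
    interior_essNumericalRange_subset_compressionNumericalRange T (M ⊔ Submodule.span ℂ B) hν
  have hvB {x : H} (hx : x ∈ B) : inner ℂ x v = 0 :=
    Submodule.inner_right_of_mem_orthogonal
      (Submodule.mem_sup_right (Submodule.subset_span hx)) hv
  refine ⟨v, Submodule.orthogonal_le le_sup_left hv, hnorm, hinner, hvB (by simp [B]), ?_,
    inner_eq_zero_symm.1 (hvB (by simp [B]))⟩
  rw [← ContinuousLinearMap.adjoint_inner_left]
  exact hvB (by simp [B])

theorem exists_inner_map_eq_add_and_inner_eq_sqrt {ν : ℂ}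
    (hν : ν ∈ interior (essNumericalRange T)) {b : H} (hbM : b ∈ Mᗮ) (hb : ‖b‖ = 1) {a : ℝ}
    (ha : a ∈ Set.Icc 0 1) :
    ∃ e ∈ Mᗮ, ‖e‖ = 1 ∧ inner ℂ e (T e) = a * inner ℂ b (T b) + (1 - a) * ν ∧
      inner ℂ e b = √a := by
  obtain ⟨v, hvM, hv, hvν, hbv, hbTv, hvTb⟩ :=
    exists_decoupled_inner_map_eq_of_mem_interior T M hν b
  have hsq_a : (√a * √a : ℂ) = a := by exact_mod_cast Real.mul_self_sqrt ha.1
  have hsq_b : (√(1 - a) * √(1 - a) : ℂ) = 1 - a := by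
    exact_mod_cast Real.mul_self_sqrt (sub_nonneg.2 ha.2)
  have hbb : inner ℂ b b = 1 := by simp [inner_self_eq_norm_sq_to_K, hb]
  have hvv : inner ℂ v v = 1 := by simp [inner_self_eq_norm_sq_to_K, hv]
  have hvb : inner ℂ v b = 0 := inner_eq_zero_symm.1 hbv
  refine ⟨(√a : ℂ) • b + (√(1 - a) : ℂ) • v,
    Mᗮ.add_mem (Mᗮ.smul_mem _ hbM) (Mᗮ.smul_mem _ hvM), ?_, ?_, ?_⟩
  · have hself : inner ℂ ((√a : ℂ) • b + (√(1 - a) : ℂ) • v) ((√a : ℂ) • b + (√(1 - a) : ℂ) • v)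
        = 1 := by
      simp only [inner_add_left, inner_add_right, inner_smul_left, inner_smul_right,
        Complex.conj_ofReal, hbb, hvv, hbv, hvb]
      linear_combination hsq_a + hsq_b
    rw [@norm_eq_sqrt_re_inner ℂ, hself, RCLike.one_re, Real.sqrt_one]
  · simp only [map_add, map_smul, inner_add_left, inner_add_right, inner_smul_left,
      inner_smul_right, Complex.conj_ofReal, hvν, hbTv, hvTb]
    linear_combination inner ℂ b (T b) * hsq_a + ν * hsq_b
  · rw [inner_add_left, inner_smul_left, inner_smul_left, hbb, hvb]
    simp

/-- Mixing in the weight `a = r / (4 * ‖T‖)` of `b` is compensated by moving `μ` to `ν`, and `ν`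
stays in the ball as `‖ν - μ‖ = a / (1 - a) * ‖μ - ⟨b, T b⟩‖ ≤ 2 * r / 3`. -/
theorem exists_inner_map_eq_and_le_norm_inner_sq {μ : ℂ} {r : ℝ} (hr : 0 < r)
    (hμ : Metric.ball μ r ⊆ essNumericalRange T) {b : H} (hbM : b ∈ Mᗮ) (hb : ‖b‖ = 1) :
    ∃ e ∈ Mᗮ, ‖e‖ = 1 ∧ inner ℂ e (T e) = μ ∧ r ≤ 4 * ‖T‖ * ‖inner ℂ e b‖ ^ 2 := by
  have hrT : r ≤ ‖T‖ := le_norm_of_ball_subset_essNumericalRange T hr.le hμ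
  have hT : 0 < ‖T‖ := hr.trans_le hrT
  set β := inner ℂ b (T b)
  have hμβ : ‖μ - β‖ ≤ 2 * ‖T‖ := by
    have hμT : ‖μ‖ ≤ ‖T‖ := by
      simpa using essNumericalRange_subset_closedBall T (hμ (Metric.mem_ball_self hr))
    linarith [norm_sub_le μ β, norm_inner_map_self_le T hb]
  obtain ⟨a, har⟩ : ∃ a, a * (4 * ‖T‖) = r := ⟨r / (4 * ‖T‖), by field_simp⟩
  have ha₀ : 0 ≤ a := by nlinarith
  have ha₁ : a ≤ 1 / 4 := by nlinarith
  let ν : ℂ := μ + (a / (1 - a) : ℝ) * (μ - β)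
  have hν : ν ∈ interior (essNumericalRange T) := by
    refine interior_maximal hμ Metric.isOpen_ball ?_
    rw [mem_ball_iff_norm, add_sub_cancel_left, norm_mul, Complex.norm_real, Real.norm_eq_abs,
      abs_of_nonneg (div_nonneg ha₀ (by linarith)), div_mul_eq_mul_div,
      div_lt_iff₀ (by linarith)]
    nlinarith
  obtain ⟨e, heM, he, heT, heb⟩ := exists_inner_map_eq_add_and_inner_eq_sqrt T M hν hbM hb
    (a := a) ⟨ha₀, by linarith⟩
  refine ⟨e, heM, he, ?_, ?_⟩
  · have h1a : (1 - a : ℂ) ≠ 0 := by exact_mod_cast (by linarith : 1 - a ≠ 0)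
    rw [heT]
    push_cast [ν]
    field_simp
    ring
  · rw [heb, Complex.norm_real, Real.norm_of_nonneg (Real.sqrt_nonneg a), Real.sq_sqrt ha₀]
    linarith

theorem exists_inner_map_eq_and_mul_norm_starProjection_sq_le {μ : ℂ} {r : ℝ} (hr : 0 < r)
    (hμ : Metric.ball μ r ⊆ essNumericalRange T) (y : H) :
    ∃ e ∈ Mᗮ, ‖e‖ = 1 ∧ inner ℂ e (T e) = μ ∧
      r * ‖Mᗮ.starProjection y‖ ^ 2 ≤ 4 * ‖T‖ * ‖inner ℂ e y‖ ^ 2 := by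
  set p := Mᗮ.starProjection y
  rcases eq_or_ne p 0 with hp | hp
  · obtain ⟨e, heM, he, heT⟩ := interior_essNumericalRange_subset_compressionNumericalRange T M
      (interior_maximal hμ Metric.isOpen_ball (Metric.mem_ball_self hr))
    exact ⟨e, heM, he, heT, by
      simp only [hp, norm_zero, ne_eq, OfNat.ofNat_ne_zero, not_false_eq_true, zero_pow, mul_zero]
      positivity⟩
  · obtain ⟨e, heM, he, heT, hle⟩ := exists_inner_map_eq_and_le_norm_inner_sq T M hr hμ
      (b := (‖p‖ : ℂ)⁻¹ • p) (Mᗮ.smul_mem _ (Mᗮ.starProjection_apply_mem y))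
      (norm_smul_inv_norm hp)
    have hey : inner ℂ e y = ‖p‖ * inner ℂ e ((‖p‖ : ℂ)⁻¹ • p) := by
      have hpC : (‖p‖ : ℂ) ≠ 0 := by simpa using hp
      rw [inner_smul_right, mul_inv_cancel_left₀ hpC, ← Mᗮ.inner_starProjection_left_eq_right,
        Submodule.starProjection_eq_self_iff.2 heM]
    refine ⟨e, heM, he, heT, ?_⟩
    rw [hey, norm_mul, Complex.norm_real, norm_norm]
    nlinarith [sq_nonneg ‖p‖]

theorem exists_inner_map_eq_and_forall_mul_norm_inner_sq_le {μ : ℂ} {r : ℝ} (hr : 0 < r)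
    (hμ : Metric.ball μ r ⊆ essNumericalRange T) (y : H) :
    ∃ e ∈ Mᗮ, ‖e‖ = 1 ∧ inner ℂ e (T e) = μ ∧
      ∀ w ∈ Mᗮ, r * ‖inner ℂ w y‖ ^ 2 ≤ ‖w‖ ^ 2 * (4 * ‖T‖) * ‖inner ℂ e y‖ ^ 2 := by
  obtain ⟨e, heM, he, heT, hle⟩ :=
    exists_inner_map_eq_and_mul_norm_starProjection_sq_le T M hr hμ y
  refine ⟨e, heM, he, heT, fun w hw => ?_⟩
  calc r * ‖inner ℂ w y‖ ^ 2
      ≤ r * (‖w‖ * ‖Mᗮ.starProjection y‖) ^ 2 := by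
        gcongr
        exact norm_inner_le_norm_mul_norm_starProjection hw y
    _ = ‖w‖ ^ 2 * (r * ‖Mᗮ.starProjection y‖ ^ 2) := by ring
    _ ≤ ‖w‖ ^ 2 * (4 * ‖T‖ * ‖inner ℂ e y‖ ^ 2) := by gcongr
    _ = ‖w‖ ^ 2 * (4 * ‖T‖) * ‖inner ℂ e y‖ ^ 2 := by ring

theorem mem_diagonals_of_ball_subset_essNumericalRange [TopologicalSpace.SeparableSpace H]
    {d : ℕ → ℂ} {r : ℕ → ℝ} (hr : ∀ k, 0 < r k)
    (hd : ∀ k, Metric.ball (d k) (r k) ⊆ essNumericalRange T) (hsum : ¬ Summable r) :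
    d ∈ diagonals T := by
  obtain ⟨m, hm⟩ := exists_forall_not_summable_indicator_fiber (fun k => (hr k).le) hsum
  let y := TopologicalSpace.denseSeq H
  obtain ⟨e, he⟩ := exists_seq_forall_rel_image_Iio fun n s (hs : s.Finite) =>
    have : FiniteDimensional ℂ (Submodule.span ℂ s) := .span_of_finite ℂ hs
    exists_inner_map_eq_and_forall_mul_norm_inner_sq_le T (Submodule.span ℂ s) (hr n) (hd n)
      (y (m n))
  choose hmem hnorm hdiag hle using he
  have horth := orthonormal_of_forall_mem_orthogonal_span_image_Iio hnorm hmem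
  have hbot : (Submodule.span ℂ (Set.range e))ᗮ = ⊥ :=
    orthogonal_span_range_eq_bot_of_not_summable horth (TopologicalSpace.denseRange_denseSeq H)
      (fun k => (hr k).le) hm fun w hw => ⟨‖w‖ ^ 2 * (4 * ‖T‖), fun k => hle k w <|
        Submodule.orthogonal_le (Submodule.span_mono (Set.image_subset_range e _)) hw⟩
  exact ⟨HilbertBasis.mkOfOrthogonalEqBot horth hbot, fun k => by simp [hdiag]⟩

end Construction

end OperatorDiagonals

theorem mainTheorem11 {H : Type*} [NormedAddCommGroup H] [InnerProductSpace ℂ H]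
    [CompleteSpace H] [TopologicalSpace.SeparableSpace H] (hH : ¬ FiniteDimensional ℂ H)
    (T : H →L[ℂ] H) (hT : ‖T‖ ≤ 1)
    (hWe : OperatorDiagonals.essNumericalRange T = Metric.closedBall (0 : ℂ) 1)
    (hFred : ¬ (T.IsFredholm ∧ OperatorDiagonals.fredholmIndex T = 0))
    (d : ℕ → ℂ) (hd : ∀ k, ‖d k‖ < 1) :
    d ∈ OperatorDiagonals.diagonals T ↔
      Tendsto (fun n => ∑ k ∈ Finset.range n, (1 - ‖d k‖)) atTop atTop := by
  have hnonneg (k : ℕ) : 0 ≤ 1 - ‖d k‖ := sub_nonneg.2 (hd k).le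
  have hball (k : ℕ) :
      Metric.ball (d k) (1 - ‖d k‖) ⊆ OperatorDiagonals.essNumericalRange T := by
    rw [hWe]
    exact (Metric.ball_subset_ball' (by simp)).trans Metric.ball_subset_closedBall
  rw [← not_summable_iff_tendsto_nat_atTop_of_nonneg hnonneg]
  constructor
  · rintro ⟨e, he⟩ hsum
    exact hFred (OperatorDiagonals.isFredholm_and_fredholmIndex_eq_zero_of_summable hT e
      (by simpa only [he] using hsum))
  · exact OperatorDiagonals.mem_diagonals_of_ball_subset_essNumericalRange T
      (fun k => sub_pos.2 (hd k)) hball
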